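/- Let $d,m,n\ge 0$ be integers and let $b_i,c_i\in GL(d,\mathbb{R})$ ($1\le i\le m$) be such that $b_i^{-1}c_i-b_j^{-1}c_j$ is invertible whenever $i\ne j$. Let $f_i$ ($1\le i\le m$) and $v_k$ ($1\le k\le n$) be locally summable (i.e. locally Lebesgue integrable) functions $\mathbb{R}^d\to\mathbb{C}$, and let $u_k:\mathbb{R}^d\to\mathbb{C}$ ($1\le k\le n$) be arbitrary functions. An exponential polynomial on $\mathbb{R}^d$ is a finite sum of functions $x\mapsto P(x)e^{\langle x,\xi\rangle}$, where $P\in\mathbb{C}[x_1,\dots,x_d]$, $\xi\in\mathbb{C}^d$ and $\langle x,\xi\rangle=\sum_j x_j\xi_j$. (1) Suppose that, for every $y\in\mathbb{R}^d$, the equation $$\sum_{i=1}^m f_i(b_ix+c_iy)=\sum_{k=1}^n u_k(y)v_k(x)$$ holds for almost every $x\in\mathbb{R}^d$. Then every $f_i$ coincides almost everywhere with an exponential polynomial. If the equation holds for all $x,y\in\mathbb{R}^d$, then every $f_i$ is (everywhere) an exponential polynomial. (2) Let moreover $N\ge 0$, let $P_s\in\mathbb{C}[x_1,\dots,x_d]$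 ($1\le s\le N$) be polynomials, and let $w_s:\mathbb{R}^d\to\mathbb{C}$ and $\varphi_s:\mathbb{R}^d\to\mathbb{C}^d$ be arbitrary functions. Suppose that, for every $y\in\mathbb{R}^d$, the equation $$\sum_{i=1}^m f_i(b_ix+c_iy)=\sum_{k=1}^n u_k(y)v_k(x)+\sum_{s=1}^N P_s(x)\,w_s(y)\,e^{\langle x,\varphi_s(y)\rangle}$$ holds for almost every $x\in\mathbb{R}^d$. Then every $f_i$ coincides almost everywhere with an exponential polynomial. If the equation holds for all $x,y\in\mathbb{R}^d$, then every $f_i$ is (everywhere) an exponential polynomial. -/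

import Mathlib

/-- The exponential monomial-type function `x ↦ P(x) exp⟨x, ξ⟩` on `ℝ^d`, where `P` is a complex
polynomial in `d` variables, `ξ ∈ ℂ^d` and `⟨x, ξ⟩ = ∑ j, x j * ξ j` (bilinear pairing). -/
noncomputable def polyExp {d : ℕ} (P : MvPolynomial (Fin d) ℂ) (ξ : Fin d → ℂ)
    (x : Fin d → ℝ) : ℂ :=
  MvPolynomial.eval (fun j => (x j : ℂ)) P * Complex.exp (∑ j, (x j : ℂ) * ξ j)

/-- `f : ℝ^d → ℂ` is an exponential polynomial: a finite sum of functions `P(x) exp⟨x, ξ⟩`. -/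
def IsExpPolynomial {d : ℕ} (f : (Fin d → ℝ) → ℂ) : Prop :=
  ∃ (N : ℕ) (P : Fin N → MvPolynomial (Fin d) ℂ) (ξ : Fin N → Fin d → ℂ),
    ∀ x, f x = ∑ s, polyExp (P s) (ξ s) x

/-! Put `g i = f i ∘ b i` and `a i = (b i)⁻¹ * c i`; the equation says that `∑ g i (x + a i y)`
lies, for each `y`, in a fixed finite-dimensional space `V` plus the exponential polynomials.
Comparing the equation at `y + h` with the translate by `a j h` of the equation at `y` kills the
`j`-th unknown. Induction on the number of unknowns (`mem_of_sum_translates_mem`) reduces everything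
to one function whose translates all lie in `V + T`, with `T` translation invariant.

Almost everywhere: smooth mollifications embed locally integrable functions modulo null functions
into continuous functions with values in a Hausdorff space, where translation is continuous, and `T`
is the space of finite vectors. A finite-dimensional subspace is invariant as soon as finitely many
translations generating a dense subgroup preserve it; hence a function with finite-dimensional orbit
modulo `T` is in `T` (`mem_finiteVectors_of_orbit`). Matrix coefficients of continuous
finite-dimensional representations are exponential polynomials, and Fubini recovers the function
itself (`exists_isExpPolynomial_ae_eq`).

Everywhere: subtract the exponential polynomials just found. The differences are null functions
satisfying an equation of the same kind, now with `T = 0`. The same elimination applies, and a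
function whose translates lie in a finite-dimensional space of null functions is zero
(`eq_zero_of_translates_mem`). -/

/-! ### Finite vectors of a group action and elimination of unknowns -/

section FiniteVectors

variable {G K X : Type*} [AddCommGroup G] [Field K] [AddCommGroup X] [Module K X]

/-- The vectors that lie in a finite-dimensional invariant subspace. -/
def finiteVectors (τ : AddChar G (Module.End K X)) : Submodule K X where
  carrier := {x | ∃ W : Submodule K X, W.FG ∧ (∀ h, W ≤ W.comap (τ h)) ∧ x ∈ W}
  zero_mem' := ⟨⊥, Submodule.fg_bot, fun _ => bot_le, Submodule.zero_mem _⟩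
  add_mem' := by
    rintro x y ⟨V, hV, hVi, hx⟩ ⟨W, hW, hWi, hy⟩
    refine ⟨V ⊔ W, hV.sup hW, fun h => sup_le ?_ ?_,
      Submodule.add_mem_sup hx hy⟩
    · exact (hVi h).trans (Submodule.comap_mono le_sup_left)
    · exact (hWi h).trans (Submodule.comap_mono le_sup_right)
  smul_mem' := by
    rintro c x ⟨V, hV, hVi, hx⟩
    exact ⟨V, hV, hVi, V.smul_mem c hx⟩

variable {τ : AddChar G (Module.End K X)}

theorem le_finiteVectors {W : Submodule K X} (hW : W.FG) (hi : ∀ h, W ≤ W.comap (τ h)) :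
    W ≤ finiteVectors τ := fun _ hx => ⟨W, hW, hi, hx⟩

theorem finiteVectors_invariant (h : G) :
    finiteVectors τ ≤ (finiteVectors τ).comap (τ h) := by
  rintro x ⟨W, hW, hi, hx⟩
  exact ⟨W, hW, hi, hi h hx⟩

/-- A finite-dimensional subspace of the space of finite vectors lies in a finite-dimensional
invariant subspace. -/
theorem exists_invariant_of_fg_le_finiteVectors {V : Submodule K X} (hV : V.FG)
    (hVT : V ≤ finiteVectors τ) :
    ∃ W : Submodule K X, W.FG ∧ (∀ h, W ≤ W.comap (τ h)) ∧ V ≤ W := by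
  induction V, hV using Submodule.fg_induction with
  | singleton x =>
    obtain ⟨W, hW, hi, hx⟩ := hVT (Submodule.mem_span_singleton_self x)
    exact ⟨W, hW, hi, (Submodule.span_singleton_le_iff_mem _ _).2 hx⟩
  | sup V₁ V₂ _ _ h₁ h₂ =>
    obtain ⟨W₁, hW₁, hi₁, hl₁⟩ := h₁ (le_sup_left.trans hVT)
    obtain ⟨W₂, hW₂, hi₂, hl₂⟩ := h₂ (le_sup_right.trans hVT)
    exact ⟨W₁ ⊔ W₂, hW₁.sup hW₂, fun h => sup_le
      ((hi₁ h).trans (Submodule.comap_mono le_sup_left))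
      ((hi₂ h).trans (Submodule.comap_mono le_sup_right)), sup_le_sup hl₁ hl₂⟩

/-- Modulo `T`, the space `O` embeds in the image of `V`, so it is finite-dimensional there; a
finite generating set lifts to `O`. -/
theorem exists_fg_le_sup_eq {V O T : Submodule K X} (hV : V.FG) (hO : O ≤ V ⊔ T) :
    ∃ V₁ : Submodule K X, V₁.FG ∧ V₁ ≤ O ∧ O ≤ V₁ ⊔ T := by
  have hfg : (O.map T.mkQ).FG := by
    have hVq : (V.map T.mkQ).FG := hV.map _
    have hle : O.map T.mkQ ≤ V.map T.mkQ := by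
      refine (Submodule.map_mono hO).trans ?_
      rw [Submodule.map_sup]
      refine sup_le le_rfl ?_
      rintro _ ⟨t, ht, rfl⟩
      rw [Submodule.mkQ_apply, (Submodule.Quotient.mk_eq_zero T).2 ht]
      exact Submodule.zero_mem _
    exact hVq.of_le hle
  classical
  obtain ⟨t, ht⟩ := hfg
  have hts : (t : Set (X ⧸ T)) ⊆ T.mkQ '' (O : Set X) := by
    rw [← Submodule.map_coe, ← ht]
    exact Submodule.subset_span
  obtain ⟨s, hsO, rfl⟩ := Finset.subset_set_image_iff.1 hts
  refine ⟨Submodule.span K s, ⟨s, rfl⟩, Submodule.span_le.2 hsO, ?_⟩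
  rw [Finset.coe_image, ← Submodule.map_span] at ht
  rw [sup_comm, ← Submodule.comap_map_mkQ, ht]
  exact Submodule.le_comap_map _ _

theorem span_orbit_invariant (f : X) (h : G) :
    Submodule.span K (Set.range fun y => τ y f) ≤
      (Submodule.span K (Set.range fun y => τ y f)).comap (τ h) := by
  rw [Submodule.span_le]
  rintro _ ⟨y, rfl⟩
  refine Submodule.subset_span ⟨h + y, ?_⟩
  simp [AddChar.map_add_eq_mul]

theorem mem_span_orbit (f : X) : f ∈ Submodule.span K (Set.range fun y => τ y f) :=
  Submodule.subset_span ⟨0, by simp⟩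

/-- If, modulo the finite vectors, the orbit of `f` spans a finite-dimensional space, then `f` is
a finite vector, as soon as there is a finite set such that every finite-dimensional subspace
invariant under this set is invariant. -/
theorem mem_finiteVectors_of_orbit (D : Set G) (hD : D.Finite)
    (hclosed : ∀ W : Submodule K X, W.FG → (∀ h ∈ D, W ≤ W.comap (τ h)) →
      ∀ h, W ≤ W.comap (τ h))
    {V : Submodule K X} (hV : V.FG) {f : X} (hf : ∀ y, τ y f ∈ V ⊔ finiteVectors τ) :
    f ∈ finiteVectors τ := by
  set O : Submodule K X := Submodule.span K (Set.range fun y => τ y f) with hOdef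
  have hO : O ≤ V ⊔ finiteVectors τ := by
    rw [hOdef, Submodule.span_le]
    rintro _ ⟨y, rfl⟩
    exact hf y
  have hOi : ∀ h, O ≤ O.comap (τ h) := span_orbit_invariant f
  have hfO : f ∈ O := mem_span_orbit f
  obtain ⟨V₁, hV₁, hV₁O, hOV₁⟩ := exists_fg_le_sup_eq hV hO
  -- Since `V₁` lies in the invariant space `O`, its image under `τ h` is in `V₁ + T`. Being
  -- finite-dimensional, that image needs only a finite-dimensional piece of `T`.
  have key : ∀ h, ∃ T₀ : Submodule K X, T₀.FG ∧ T₀ ≤ finiteVectors τ ∧ V₁.map (τ h) ≤ V₁ ⊔ T₀ := by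
    intro h
    have hle : V₁.map (τ h) ≤ finiteVectors τ ⊔ V₁ := by
      rw [sup_comm]
      exact (Submodule.map_le_iff_le_comap.2 (hV₁O.trans (hOi h))).trans hOV₁
    obtain ⟨T₀, h1, h2, h3⟩ := exists_fg_le_sup_eq (hV₁.map (τ h)) (T := V₁)
      (O := finiteVectors τ ⊓ (V₁.map (τ h) ⊔ V₁)) inf_le_right
    refine ⟨T₀, h1, h2.trans inf_le_left, fun x hx => ?_⟩
    obtain ⟨t, ht, v, hv, rfl⟩ := Submodule.mem_sup.1 (hle hx)
    rw [sup_comm]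
    have : t ∈ T₀ ⊔ V₁ := h3 ⟨ht, by
      have := Submodule.sub_mem _ (Submodule.mem_sup_left (S := V₁.map (τ h)) (T := V₁) hx)
        (Submodule.mem_sup_right hv)
      simpa using this⟩
    exact Submodule.add_mem _ this (Submodule.mem_sup_right hv)
  choose T₀ hT₀ hT₀le hT₀map using key
  -- Finiteness of `D` enters here: the pieces for all `h ∈ D` fit into one finite-dimensional
  -- invariant `W`, and `V₁ ⊔ W` is then stable under `D`.
  obtain ⟨W, hW, hWi, hTW⟩ := exists_invariant_of_fg_le_finiteVectors (τ := τ)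
    (V := ⨆ h ∈ hD.toFinset, T₀ h) (Submodule.fg_biSup _ _ fun h _ => hT₀ h)
    (iSup₂_le fun h _ => hT₀le h)
  have hinv := hclosed (V₁ ⊔ W) (hV₁.sup hW) (by
    intro h hh
    refine sup_le ?_ ((hWi h).trans (Submodule.comap_mono le_sup_right))
    refine Submodule.map_le_iff_le_comap.1 ((hT₀map h).trans (sup_le_sup le_rfl ?_))
    refine le_trans ?_ hTW
    exact le_iSup₂_of_le h (hD.mem_toFinset.2 hh) le_rfl)
  have := le_finiteVectors (hV₁.sup hW) hinv
  exact (hOV₁.trans (sup_le (le_sup_left.trans this) le_rfl)) hfO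

/-- Elimination of all but one of the unknown vectors. -/
theorem mem_of_sum_translates_mem {ι : Type*} [DecidableEq ι] (a : ι → G →+ G)
    (ha : ∀ i, Function.Surjective (a i))
    (hab : ∀ i j, i ≠ j → Function.Surjective (a i - a j))
    {N T : Submodule K X} (hN : ∀ h, N ≤ N.comap (τ h)) (hT : ∀ h, T ≤ T.comap (τ h))
    (hone : ∀ V : Submodule K X, V.FG → V ≤ N → ∀ f ∈ N, (∀ y, τ y f ∈ V ⊔ T) → f ∈ T)
    (s : Finset ι) :
    ∀ f : ι → X, (∀ i ∈ s, f i ∈ N) → ∀ V : Submodule K X, V.FG → V ≤ N →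
      (∀ y, ∑ i ∈ s, τ (a i y) (f i) ∈ V ⊔ T) → ∀ i ∈ s, f i ∈ T := by
  induction hn : s.card generalizing s with
  | zero =>
    intro f _ V _ _ _ i hi
    rw [Finset.card_eq_zero.1 hn] at hi
    simp at hi
  | succ n ih =>
    intro f hfN V hV hVN hsum i hi
    by_cases hs : (s.erase i).Nonempty
    · obtain ⟨j, hj⟩ := hs
      obtain ⟨hji, hjs⟩ := Finset.mem_erase.1 hj
      -- The equation at `y + h` minus `τ (a j h)` of the equation at `y` has no `j`-th term; the
      -- error space grows only from `V` to `V ⊔ τ (a j h) V`.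
      have hmain : ∀ h, τ (a i h) (f i) - τ (a j h) (f i) ∈ T := by
        intro h
        refine ih (s.erase j) (by rw [Finset.card_erase_of_mem hjs, hn]; rfl)
          (fun k => τ (a k h) (f k) - τ (a j h) (f k)) ?_ (V ⊔ V.map (τ (a j h)))
          (hV.sup (hV.map _)) (sup_le hVN ?_) ?_ i (Finset.mem_erase.2 ⟨hji.symm, hi⟩)
        · intro k hk
          have := hfN k (Finset.mem_of_mem_erase hk)
          exact N.sub_mem (hN _ this) (hN _ this)
        · exact Submodule.map_le_iff_le_comap.2 (hVN.trans (hN _))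
        · intro y
          have h1 : ∑ k ∈ s, τ (a k (y + h)) (f k) ∈ (V ⊔ V.map (τ (a j h))) ⊔ T :=
            (sup_le_sup le_sup_left le_rfl : V ⊔ T ≤ _) (hsum (y + h))
          have h2 : τ (a j h) (∑ k ∈ s, τ (a k y) (f k)) ∈ (V ⊔ V.map (τ (a j h))) ⊔ T := by
            obtain ⟨v, hv, t, ht, hvt⟩ := Submodule.mem_sup.1 (hsum y)
            rw [← hvt, map_add]
            exact Submodule.add_mem_sup (Submodule.mem_sup_right (Submodule.mem_map_of_mem hv))
              (hT _ ht)
          have h3 := Submodule.sub_mem _ h1 h2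
          rw [map_sum, ← Finset.sum_sub_distrib] at h3
          have e : ∀ k, τ (a k (y + h)) (f k) - τ (a j h) (τ (a k y) (f k)) =
              τ (a k y) (τ (a k h) (f k) - τ (a j h) (f k)) := by
            intro k
            rw [map_sub, map_add, add_comm (a k y), ← Module.End.mul_apply,
              ← Module.End.mul_apply, ← Module.End.mul_apply, ← AddChar.map_add_eq_mul,
              ← AddChar.map_add_eq_mul, ← AddChar.map_add_eq_mul, add_comm (a k y),
              add_comm (a k y)]
          have e0 : τ (a j (y + h)) (f j) - τ (a j h) (τ (a j y) (f j)) = 0 := by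
            rw [e, sub_self, map_zero]
          rw [← Finset.add_sum_erase _ _ hjs, e0, zero_add] at h3
          simpa only [e] using h3
      -- Translating `hmain` by `-(a j h)` shows that `f i` is fixed modulo `T` by every `(a i - a
      -- j) h`, hence by all of `G`.
      refine hone (Submodule.span K {f i}) (Submodule.fg_span_singleton _)
        ((Submodule.span_singleton_le_iff_mem _ _).2 (hfN i hi)) _ (hfN i hi) fun y => ?_
      obtain ⟨h, rfl⟩ := hab i j hji.symm y
      have := hT (-(a j h)) (hmain h)
      have e : τ ((a i - a j) h) (f i) = f i + τ (-(a j h)) (τ (a i h) (f i) - τ (a j h) (f i)) := by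
        rw [map_sub, ← Module.End.mul_apply, ← Module.End.mul_apply, ← AddChar.map_add_eq_mul,
          ← AddChar.map_add_eq_mul, neg_add_cancel, AddMonoidHom.sub_apply, neg_add_eq_sub]
        simp
      rw [e]
      exact Submodule.add_mem_sup (Submodule.mem_span_singleton_self _) this
    · rw [Finset.not_nonempty_iff_eq_empty] at hs
      have hsi : s = {i} := by
        rw [← Finset.insert_erase hi, hs]
        rfl
      subst hsi
      refine hone V hV hVN _ (hfN i hi) fun y => ?_
      obtain ⟨z, rfl⟩ := ha i y
      simpa using hsum z

end FiniteVectors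

/-! ### The algebra of exponential polynomials -/

section ExpPolynomials

variable {d : ℕ}

theorem IsExpPolynomial.of_fintype {ι : Type*} [Fintype ι] (P : ι → MvPolynomial (Fin d) ℂ)
    (ξ : ι → Fin d → ℂ) : IsExpPolynomial fun x => ∑ i, polyExp (P i) (ξ i) x := by
  let e := (Fintype.equivFin ι).symm
  exact ⟨Fintype.card ι, P ∘ e, ξ ∘ e, fun x =>
    (Equiv.sum_comp e fun i => polyExp (P i) (ξ i) x).symm⟩

theorem isExpPolynomial_polyExp (P : MvPolynomial (Fin d) ℂ) (ξ : Fin d → ℂ) :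
    IsExpPolynomial (polyExp P ξ) :=
  ⟨1, fun _ => P, fun _ => ξ, fun x => by simp⟩

theorem polyExp_mul_polyExp (P Q : MvPolynomial (Fin d) ℂ) (ξ η : Fin d → ℂ) (x : Fin d → ℝ) :
    polyExp P ξ x * polyExp Q η x = polyExp (P * Q) (ξ + η) x := by
  simp only [polyExp, map_mul, Pi.add_apply, mul_add, Finset.sum_add_distrib, Complex.exp_add]
  ring

theorem polyExp_zero_right (P : MvPolynomial (Fin d) ℂ) (x : Fin d → ℝ) :
    polyExp P 0 x = MvPolynomial.eval (fun j => (x j : ℂ)) P := by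
  simp [polyExp]

theorem polyExp_one_left (ξ : Fin d → ℂ) (x : Fin d → ℝ) :
    polyExp 1 ξ x = Complex.exp (∑ j, (x j : ℂ) * ξ j) := by
  simp [polyExp]

/-- The algebra of exponential polynomials. -/
def expPolynomials (d : ℕ) : Subalgebra ℂ ((Fin d → ℝ) → ℂ) where
  carrier := {f | IsExpPolynomial f}
  mul_mem' := by
    rintro f g ⟨N, P, ξ, hf⟩ ⟨M, Q, η, hg⟩
    change IsExpPolynomial _
    convert IsExpPolynomial.of_fintype (fun i : Fin N × Fin M => P i.1 * Q i.2)
      (fun i => ξ i.1 + η i.2) using 1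
    ext x
    simp only [Pi.mul_apply, hf, hg, Finset.sum_mul_sum, Fintype.sum_prod_type,
      polyExp_mul_polyExp]
  add_mem' := by
    rintro f g ⟨N, P, ξ, hf⟩ ⟨M, Q, η, hg⟩
    change IsExpPolynomial _
    convert IsExpPolynomial.of_fintype (Sum.elim P Q) (Sum.elim ξ η) using 1
    ext x
    simp [hf, hg]
  algebraMap_mem' c := by
    change IsExpPolynomial _
    convert isExpPolynomial_polyExp (MvPolynomial.C c) 0 using 1
    ext x
    simp [polyExp_zero_right]

theorem mem_expPolynomials {f : (Fin d → ℝ) → ℂ} :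
    f ∈ expPolynomials d ↔ IsExpPolynomial f := Iff.rfl

theorem coord_mem_expPolynomials (j : Fin d) :
    (fun x : Fin d → ℝ => (x j : ℂ)) ∈ expPolynomials d := by
  rw [mem_expPolynomials]
  convert isExpPolynomial_polyExp (MvPolynomial.X j) 0 using 1
  ext x
  simp [polyExp_zero_right]

theorem const_mem_expPolynomials (c : ℂ) : (fun _ : Fin d → ℝ => c) ∈ expPolynomials d :=
  (expPolynomials d).algebraMap_mem c

theorem exp_mem_expPolynomials (ξ : Fin d → ℂ) (c : ℂ) :
    (fun x : Fin d → ℝ => Complex.exp (∑ j, (x j : ℂ) * ξ j + c)) ∈ expPolynomials d := by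
  convert (expPolynomials d).mul_mem (isExpPolynomial_polyExp 1 ξ)
    (const_mem_expPolynomials (Complex.exp c)) using 1
  ext x
  simp [polyExp_one_left, Complex.exp_add]

/-- Exponential polynomials are stable under affine changes of the variables. -/
theorem IsExpPolynomial.comp_affine {e : ℕ} {f : (Fin d → ℝ) → ℂ} (hf : IsExpPolynomial f)
    (M : Matrix (Fin d) (Fin e) ℝ) (β : Fin d → ℝ) :
    IsExpPolynomial fun x => f (M.mulVec x + β) := by
  obtain ⟨N, P, ξ, hf⟩ := hf
  have hcoord : ∀ j, (fun x : Fin e → ℝ => ((M.mulVec x + β) j : ℂ)) ∈ expPolynomials e := by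
    intro j
    have : (fun x : Fin e → ℝ => ((M.mulVec x + β) j : ℂ)) =
        ∑ l, (M j l : ℂ) • (fun x : Fin e → ℝ => (x l : ℂ)) + fun _ => (β j : ℂ) := by
      ext x
      simp [Matrix.mulVec, dotProduct]
    rw [this]
    exact Subalgebra.add_mem _ (Subalgebra.sum_mem _ fun l _ =>
      Subalgebra.smul_mem _ (coord_mem_expPolynomials l) _) (const_mem_expPolynomials _)
  have hpoly : ∀ Q : MvPolynomial (Fin d) ℂ, (fun x : Fin e → ℝ =>
      MvPolynomial.eval (fun j => ((M.mulVec x + β) j : ℂ)) Q) ∈ expPolynomials e := by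
    intro Q
    induction Q using MvPolynomial.induction_on with
    | C a => simpa using const_mem_expPolynomials a
    | add p q hp hq => simpa using! Subalgebra.add_mem _ hp hq
    | mul_X p j hp => simpa using! Subalgebra.mul_mem _ hp (hcoord j)
  have hexp : ∀ η : Fin d → ℂ, (fun x : Fin e → ℝ =>
      Complex.exp (∑ j, ((M.mulVec x + β) j : ℂ) * η j)) ∈ expPolynomials e := by
    intro η
    convert exp_mem_expPolynomials (fun l => ∑ j, (M j l : ℂ) * η j) (∑ j, (β j : ℂ) * η j)
      using 3 with x
    simp only [Pi.add_apply, Complex.ofReal_add, add_mul, Finset.sum_add_distrib, Matrix.mulVec,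
      dotProduct, Complex.ofReal_sum, Complex.ofReal_mul, Finset.sum_mul, Finset.mul_sum]
    congr 1
    rw [Finset.sum_comm]
    exact Finset.sum_congr rfl fun l _ => Finset.sum_congr rfl fun j _ => by ring
  have : (fun x : Fin e → ℝ => f (M.mulVec x + β)) = ∑ s, (fun x : Fin e → ℝ =>
      MvPolynomial.eval (fun j => ((M.mulVec x + β) j : ℂ)) (P s)) * (fun x : Fin e → ℝ =>
      Complex.exp (∑ j, ((M.mulVec x + β) j : ℂ) * ξ s j)) := by
    ext x
    simp [hf, polyExp]
  rw [← mem_expPolynomials, this]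
  exact Subalgebra.sum_mem _ fun s _ => Subalgebra.mul_mem _ (hpoly _) (hexp _)

theorem continuous_polyExp (P : MvPolynomial (Fin d) ℂ) (ξ : Fin d → ℂ) :
    Continuous (polyExp P ξ) := by
  unfold polyExp
  refine Continuous.mul ?_ (by fun_prop)
  exact (MvPolynomial.continuous_eval P).comp (by fun_prop)

theorem IsExpPolynomial.continuous {f : (Fin d → ℝ) → ℂ} (hf : IsExpPolynomial f) :
    Continuous f := by
  obtain ⟨N, P, ξ, hf⟩ := hf
  rw [funext hf]
  exact continuous_finsetSum _ fun s _ => continuous_polyExp _ _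

end ExpPolynomials

/-! ### Translations of continuous functions -/

section Translation

variable {G : Type*} [AddCommGroup G] [TopologicalSpace G] [ContinuousAdd G]

/-- The action of `G` on continuous functions on `G` by translations, `f ↦ f (· + h)`. -/
def translation (Y : Type*) [AddCommGroup Y] [TopologicalSpace Y] [IsTopologicalAddGroup Y]
    [Module ℂ Y] [ContinuousConstSMul ℂ Y] : AddChar G (Module.End ℂ C(G, Y)) where
  toFun h :=
    { toFun := fun F => ⟨fun x => F (x + h), by fun_prop⟩
      map_add' := fun _ _ => rfl
      map_smul' := fun _ _ => rfl }
  map_zero_eq_one' := by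
    ext F x
    simp
  map_add_eq_mul' a b := by
    ext F x
    simp [add_comm a b, add_assoc]

variable {Y : Type*} [AddCommGroup Y] [TopologicalSpace Y] [IsTopologicalAddGroup Y]
    [Module ℂ Y] [ContinuousConstSMul ℂ Y]

@[simp]
theorem translation_apply (h : G) (F : C(G, Y)) (x : G) : translation Y h F x = F (x + h) := rfl

/-- Translation is multiplicative, so the product of two invariant finite-dimensional spaces is
again one. -/
theorem mul_mem_finiteVectors_translation {F H : C(G, ℂ)}
    (hF : F ∈ finiteVectors (translation (G := G) ℂ))
    (hH : H ∈ finiteVectors (translation (G := G) ℂ)) :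
    F * H ∈ finiteVectors (translation (G := G) ℂ) := by
  obtain ⟨V, hV, hVi, hFV⟩ := hF
  obtain ⟨W, hW, hWi, hHW⟩ := hH
  refine ⟨V * W, hV.mul hW, fun h => Submodule.mul_le.2 fun v hv w hw => ?_,
    Submodule.mul_mem_mul hFV hHW⟩
  exact Submodule.mul_mem_mul (show translation ℂ h v ∈ V from hVi h hv)
    (show translation ℂ h w ∈ W from hWi h hw)

theorem polyExp_mem_finiteVectors {d : ℕ} (P : MvPolynomial (Fin d) ℂ) (ξ : Fin d → ℂ) :
    (⟨polyExp P ξ, continuous_polyExp P ξ⟩ : C(Fin d → ℝ, ℂ)) ∈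
      finiteVectors (translation (G := Fin d → ℝ) ℂ) := by
  have hconst : ∀ c : ℂ, ContinuousMap.const (Fin d → ℝ) c ∈
      finiteVectors (translation (G := Fin d → ℝ) ℂ) := by
    intro c
    refine le_finiteVectors (Submodule.fg_span_singleton (ContinuousMap.const (Fin d → ℝ) c))
      (fun h => ?_) (Submodule.mem_span_singleton_self _)
    rw [Submodule.span_singleton_le_iff_mem]
    exact Submodule.mem_span_singleton_self _
  have hexp : (⟨polyExp 1 ξ, continuous_polyExp 1 ξ⟩ : C(Fin d → ℝ, ℂ)) ∈
      finiteVectors (translation (G := Fin d → ℝ) ℂ) := by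
    refine le_finiteVectors (Submodule.fg_span_singleton _)
      (fun h => ?_) (Submodule.mem_span_singleton_self _)
    rw [Submodule.span_singleton_le_iff_mem]
    refine Submodule.mem_span_singleton.2 ⟨polyExp 1 ξ h, ?_⟩
    ext x
    simp only [polyExp_one_left, ContinuousMap.coe_smul, ContinuousMap.coe_mk, Pi.smul_apply,
      smul_eq_mul, translation_apply, Pi.add_apply, Complex.ofReal_add, add_mul,
      Finset.sum_add_distrib, Complex.exp_add]
    ring
  have hX : ∀ j, (⟨fun x => (x j : ℂ), by fun_prop⟩ : C(Fin d → ℝ, ℂ)) ∈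
      finiteVectors (translation (G := Fin d → ℝ) ℂ) := by
    intro j
    set F : C(Fin d → ℝ, ℂ) := ⟨fun x => (x j : ℂ), by fun_prop⟩ with hF
    refine le_finiteVectors (W := Submodule.span ℂ {F, 1})
      (Submodule.fg_span (by simp)) (fun h => ?_) (Submodule.subset_span (by simp))
    rw [Submodule.span_le, Set.insert_subset_iff, Set.singleton_subset_iff]
    constructor
    · have : translation ℂ h F = F + (h j : ℂ) • 1 := by
        ext x
        simp [hF]
      change translation ℂ h F ∈ Submodule.span ℂ {F, 1}
      rw [this]
      exact Submodule.add_mem _ (Submodule.subset_span (by simp))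
        (Submodule.smul_mem _ _ (Submodule.subset_span (by simp)))
    · exact Submodule.subset_span (Or.inr rfl)
  have hpoly : (⟨polyExp P 0, continuous_polyExp P 0⟩ : C(Fin d → ℝ, ℂ)) ∈
      finiteVectors (translation (G := Fin d → ℝ) ℂ) := by
    induction P using MvPolynomial.induction_on with
    | C a =>
      convert hconst a using 1
      ext x
      simp [polyExp_zero_right]
    | add p q hp hq =>
      convert Submodule.add_mem _ hp hq using 1
      ext x
      simp [polyExp_zero_right]
    | mul_X p j hp =>
      convert mul_mem_finiteVectors_translation hp (hX j) using 1
      ext x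
      simp [polyExp_zero_right]
  convert mul_mem_finiteVectors_translation hpoly hexp using 1
  ext x
  simp [polyExp_mul_polyExp]

end Translation

/-! ### Finite-dimensional representations of `ℝ^d` -/

section OneParameterGroups

open Filter Topology in
/-- A continuous one-parameter group in a Banach algebra is differentiable. -/
theorem exists_hasDerivAt_of_continuous_oneParameter {A : Type*} [NormedRing A]
    [NormedAlgebra ℝ A] [CompleteSpace A] (a : ℝ → A) (h0 : a 0 = 1)
    (hadd : ∀ s t, a (s + t) = a s * a t) (hc : Continuous a) :
    ∃ B : A, ∀ t, HasDerivAt a (B * a t) t := by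
  set F : ℝ → A := fun t => ∫ s in (0 : ℝ)..t, a s with hF
  have hFd : ∀ t, HasDerivAt F (a t) t := fun t => hc.integral_hasStrictDerivAt 0 t |>.hasDerivAt
  -- The averages `F t / t` tend to `a 0 = 1`, and units form an open set.
  obtain ⟨ε, hε⟩ : ∃ ε : ℝ, IsUnit (F ε) := by
    have h1 : Tendsto (slope F 0) (𝓝[≠] 0) (𝓝 1) := by
      rw [← h0]
      exact hasDerivAt_iff_tendsto_slope.1 (hFd 0)
    have h2 : ∀ᶠ t in 𝓝[≠] (0 : ℝ), IsUnit (slope F 0 t) :=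
      h1.eventually (Units.isOpen.mem_nhds isUnit_one)
    obtain ⟨t, ht, (ht0 : t ≠ 0)⟩ := (h2.and self_mem_nhdsWithin).exists
    refine ⟨t, ?_⟩
    have : F t = (Units.mk0 t ht0) • slope F 0 t := by
      rw [Units.smul_def, Units.val_mk0, slope_def_module, sub_zero, smul_inv_smul₀ ht0]
      simp [hF]
    rw [this]
    exact (ht.smul _)
  obtain ⟨M, hM⟩ := hε
  -- The group law gives `F (ε + t) - F t = F ε * a t`, which expresses `a` through the
  -- differentiable function `F`.
  have hMa : ∀ t, a t = ↑M⁻¹ * (F (ε + t) - F t) := by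
    intro t
    have : F (ε + t) - F t = F ε * a t := by
      rw [hF]
      simp only
      rw [intervalIntegral.integral_interval_sub_left (hc.intervalIntegrable _ _)
        (hc.intervalIntegrable _ _)]
      change _ = (ContinuousLinearMap.mul ℝ A).flip (a t) (∫ s in (0 : ℝ)..ε, a s)
      rw [
        ← ((ContinuousLinearMap.mul ℝ A).flip (a t)).intervalIntegral_comp_comm
          (hc.intervalIntegrable 0 ε)]
      simp [← hadd]
    rw [this, ← hM, Units.inv_mul_cancel_left]
  refine ⟨↑M⁻¹ * (a ε - 1), fun t => ?_⟩
  have := (((hFd (ε + t)).comp_const_add ε t).sub (hFd t)).const_mul (↑M⁻¹ : A)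
  rw [hadd ε t] at this
  rw [mul_assoc, sub_mul, one_mul]
  refine this.congr_of_eventuallyEq ?_
  exact Eventually.of_forall hMa

variable {E : Type*} [NormedAddCommGroup E] [NormedSpace ℂ E]

/-- The solution of `q' = B q` starting at a generalized eigenvector `v` of `B = μ + N`. -/
noncomputable def genEigenCurve (N : Module.End ℂ E) (μ : ℂ) (k : ℕ) (v : E) (t : ℝ) : E :=
  Complex.exp (t * μ) • ∑ i ∈ Finset.range k, ((t : ℂ) ^ i / (i.factorial : ℂ)) • (N ^ i) v

theorem hasDerivAt_sum_pow_div_factorial (N : Module.End ℂ E) (v : E) (k : ℕ) (t : ℝ) :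
    HasDerivAt (fun t : ℝ => ∑ i ∈ Finset.range (k + 1),
      ((t : ℂ) ^ i / (i.factorial : ℂ)) • (N ^ i) v)
      (N (∑ i ∈ Finset.range k, ((t : ℂ) ^ i / (i.factorial : ℂ)) • (N ^ i) v)) t := by
  induction k with
  | zero => simpa using hasDerivAt_const t v
  | succ k ih =>
    simp_rw [Finset.sum_range_succ _ (k + 1)]
    rw [Finset.sum_range_succ _ k, map_add, map_smul, ← Module.End.mul_apply, ← pow_succ']
    refine ih.add (HasDerivAt.smul_const ?_ _)
    have h := ((hasDerivAt_pow (k + 1) (t : ℂ)).comp_ofReal).div_const ((k + 1).factorial : ℂ)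
    convert h using 1
    have h1 : (k.factorial : ℂ) ≠ 0 := by exact_mod_cast k.factorial_ne_zero
    have h2 : ((k : ℂ) + 1) ≠ 0 := by exact_mod_cast k.succ_ne_zero
    rw [Nat.factorial_succ]
    push_cast
    field_simp

/-- Differentiating the truncated exponential series drops its top term; `N ^ k v = 0` makes the two
truncations agree. -/
theorem hasDerivAt_genEigenCurve {N : Module.End ℂ E} {k : ℕ} {v : E} (hk : (N ^ k) v = 0)
    (μ : ℂ) (t : ℝ) :
    HasDerivAt (genEigenCurve N μ k v)
      (μ • genEigenCurve N μ k v t + N (genEigenCurve N μ k v t)) t := by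
  have h1 := hasDerivAt_sum_pow_div_factorial N v k t
  simp_rw [Finset.sum_range_succ _ k, hk, smul_zero, add_zero] at h1
  have h2 : HasDerivAt (fun t : ℝ => Complex.exp (t * μ)) (Complex.exp (t * μ) * μ) t := by
    have := ((hasDerivAt_mul_const (x := (t : ℂ)) μ).cexp).comp_ofReal
    simpa using this
  convert h2.smul h1 using 1
  · rfl
  · simp only [genEigenCurve, map_smul, smul_smul]
    rw [add_comm, mul_comm μ]

theorem coord_comp_mem_expPolynomials_of_oneParameter [FiniteDimensional ℂ E] {d : ℕ} (j : Fin d)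
    (a : ℝ → E →L[ℂ] E) (h0 : a 0 = 1) (hadd : ∀ s t, a (s + t) = a s * a t) (hc : Continuous a)
    (v : E) (l : Module.Dual ℂ E) :
    (fun h : Fin d → ℝ => l (a (h j) v)) ∈ expPolynomials d := by
  have : CompleteSpace E := FiniteDimensional.complete ℂ E
  obtain ⟨B, hB⟩ := exists_hasDerivAt_of_continuous_oneParameter a h0 hadd hc
  -- Over `ℂ` the generalized eigenspaces of `B` span `E`, and the claim is linear in `v`.
  have hv : v ∈ ⨆ μ, Module.End.maxGenEigenspace (B : Module.End ℂ E) μ := by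
    rw [Module.End.iSup_maxGenEigenspace_eq_top]
    trivial
  induction hv using Submodule.iSup_induction' with
  | zero => simpa using const_mem_expPolynomials (d := d) 0
  | add x y _ _ hx hy => simpa using! (expPolynomials d).add_mem hx hy
  | mem μ v hv =>
    obtain ⟨k, hk⟩ := (Module.End.mem_maxGenEigenspace _ _ _).1 hv
    set N : Module.End ℂ E := (B : Module.End ℂ E) - μ • 1 with hN
    have hNB : ∀ x, B x = μ • x + N x := by
      intro x
      simp [hN]
    have heq : (fun t => a t v) = genEigenCurve N μ k v := by
      refine ODE_solution_unique_univ (v := fun _ x => B x) (s := fun _ => Set.univ)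
        (K := ‖B‖₊) (t₀ := 0) (fun _ => B.lipschitz.lipschitzOnWith)
        (fun t => ⟨?_, trivial⟩) (fun t => ⟨?_, trivial⟩) ?_
      · have := ((ContinuousLinearMap.apply ℂ E v).restrictScalars ℝ).hasFDerivAt.comp_hasDerivAt
          t (hB t)
        exact this
      · rw [hNB]
        exact hasDerivAt_genEigenCurve hk μ t
      -- For `k = 0` the sum defining the curve is empty, but `N ^ 0 v = 0` already forces `v = 0`.
      · rcases k with _ | k
        · have : v = 0 := by simpa using hk
          simp [genEigenCurve, this]
        · simp [genEigenCurve, h0, Finset.sum_range_succ']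
    have : (fun h : Fin d → ℝ => l (a (h j) v)) =
        (fun h : Fin d → ℝ => Complex.exp (∑ i, (h i : ℂ) * (Pi.single j μ : Fin d → ℂ) i + 0)) *
        ∑ i ∈ Finset.range k, (l ((N ^ i) v) / (i.factorial : ℂ)) •
          (fun h : Fin d → ℝ => (h j : ℂ)) ^ i := by
      ext h
      rw [congrFun heq (h j)]
      simp only [genEigenCurve, map_smul, map_sum, smul_eq_mul, Pi.mul_apply, Finset.sum_apply,
        Pi.smul_apply, Pi.pow_apply, Pi.single_apply, mul_ite, mul_zero, Finset.sum_ite_eq',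
        Finset.mem_univ, if_true, add_zero]
      congr 1
      exact Finset.sum_congr rfl fun i _ => by ring
    rw [this]
    exact Subalgebra.mul_mem _ (exp_mem_expPolynomials _ _) (Subalgebra.sum_mem _ fun i _ =>
      Subalgebra.smul_mem _ (Subalgebra.pow_mem _ (coord_mem_expPolynomials j) _) _)

/-- The matrix coefficients of a continuous finite-dimensional representation of `ℝ^d` are
exponential polynomials. -/
theorem matrixCoeff_mem_expPolynomials [FiniteDimensional ℂ E] {d : ℕ}
    (a : (Fin d → ℝ) → Module.End ℂ E) (h0 : a 0 = 1) (hadd : ∀ x y, a (x + y) = a x * a y)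
    (hc : ∀ v, Continuous fun h => a h v) (v : E) (l : Module.Dual ℂ E) :
    (fun h => l (a h v)) ∈ expPolynomials d := by
  have hone : ∀ (j : Fin d) (v : E) (l : Module.Dual ℂ E),
      (fun h : Fin d → ℝ => l (a (Pi.single j (h j)) v)) ∈ expPolynomials d := by
    intro j v l
    refine coord_comp_mem_expPolynomials_of_oneParameter j
      (fun t => LinearMap.toContinuousLinearMap (a (Pi.single j t))) ?_ ?_ ?_ v l
    · ext x
      simp [h0]
    · intro s t
      ext x
      simp [Pi.single_add, hadd]
    · rw [continuous_clm_apply]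
      intro y
      exact (hc y).comp (continuous_single (A := fun _ => ℝ) j)
  have hs : ∀ (s : Finset (Fin d)) (l : Module.Dual ℂ E),
      (fun h : Fin d → ℝ => l (a (∑ j ∈ s, Pi.single j (h j)) v)) ∈ expPolynomials d := by
    intro s
    induction s using Finset.induction_on with
    | empty =>
      intro l
      simpa [h0] using const_mem_expPolynomials (l v)
    | insert j s hj ih =>
      intro l
      let b := Module.finBasis ℂ E
      have : (fun h : Fin d → ℝ => l (a (∑ j ∈ insert j s, Pi.single j (h j)) v)) =
          ∑ k, (fun h : Fin d → ℝ => b.coord k (a (∑ j ∈ s, Pi.single j (h j)) v)) *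
            (fun h : Fin d → ℝ => l (a (Pi.single j (h j)) (b k))) := by
        ext h
        rw [Finset.sum_insert hj, hadd, Module.End.mul_apply]
        have := congrArg (fun w => l (a (Pi.single j (h j)) w))
          (b.sum_repr (a (∑ j ∈ s, Pi.single j (h j)) v))
        simp only [map_sum, map_smul, smul_eq_mul] at this
        simpa using! this.symm
      rw [this]
      exact Subalgebra.sum_mem _ fun k _ => Subalgebra.mul_mem _ (ih _) (hone j _ _)
  simpa only [Finset.univ_sum_single] using hs Finset.univ l

end OneParameterGroups

/-! ### Invariant finite-dimensional spaces of continuous functions -/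

section ContinuousTranslation

variable {Y : Type*} [AddCommGroup Y] [TopologicalSpace Y] [IsTopologicalAddGroup Y]
    [Module ℂ Y] [ContinuousSMul ℂ Y] {d : ℕ}

theorem continuous_translation (F : C(Fin d → ℝ, Y)) :
    Continuous fun h => translation Y h F := by
  let Φ : C((Fin d → ℝ) × (Fin d → ℝ), Y) := ⟨fun p => F (p.2 + p.1), by fun_prop⟩
  exact Φ.curry.continuous

variable [T2Space Y]

theorem isClosed_setOf_translation_invariant {W : Submodule ℂ C(Fin d → ℝ, Y)} (hW : W.FG) :
    IsClosed {h | W ≤ W.comap (translation Y h)} := by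
  have : FiniteDimensional ℂ W := Module.Finite.iff_fg.2 hW
  have hcl : IsClosed (W : Set C(Fin d → ℝ, Y)) := W.closed_of_finiteDimensional
  have : {h | W ≤ W.comap (translation Y h)} =
      ⋂ F ∈ W, (fun h => translation Y h F) ⁻¹' (W : Set C(Fin d → ℝ, Y)) := by
    ext h
    simp [SetLike.le_def]
  rw [this]
  exact isClosed_biInter fun F _ => hcl.preimage (continuous_translation F)

/-- Finitely many vectors generating a dense subgroup of `ℝ^d`. -/
def denseGenerators (d : ℕ) : Set (Fin d → ℝ) :=
  Set.range fun p : Fin d × Bool × Bool =>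
    Pi.single p.1 ((if p.2.1 then 1 else -1) * (if p.2.2 then 1 else √2))

/-- The translations preserving `W` form a closed additive monoid, because `W` is closed and
translation is continuous. On each axis, `1` and `√2` generate a dense subgroup. -/
theorem invariant_of_invariant_denseGenerators {W : Submodule ℂ C(Fin d → ℝ, Y)} (hW : W.FG)
    (hi : ∀ h ∈ denseGenerators d, W ≤ W.comap (translation Y h)) (h : Fin d → ℝ) :
    W ≤ W.comap (translation Y h) := by
  set Q : Set (Fin d → ℝ) := {h | W ≤ W.comap (translation Y h)} with hQ
  have hQc : IsClosed Q := isClosed_setOf_translation_invariant hW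
  have hQ0 : (0 : Fin d → ℝ) ∈ Q := by
    intro F hF
    simpa using hF
  have hQadd : ∀ x ∈ Q, ∀ y ∈ Q, x + y ∈ Q := by
    intro x hx y hy F hF
    rw [Submodule.mem_comap, AddChar.map_add_eq_mul]
    exact hx (hy hF)
  have hgen : ∀ (j : Fin d) (p q : Bool),
      Pi.single j ((if p then 1 else -1) * (if q then 1 else √2)) ∈ Q :=
    fun j p q => hi _ ⟨(j, p, q), rfl⟩
  have hsingle : ∀ (j : Fin d) (t : ℝ), Pi.single j t ∈ Q := by
    intro j t
    have hcl : IsClosed {t : ℝ | (Pi.single j t : Fin d → ℝ) ∈ Q} :=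
      hQc.preimage (continuous_single j)
    have hdense : Dense (AddSubgroup.closure {√2, 1} : Set ℝ) := by
      rw [dense_addSubgroupClosure_pair_iff, div_one]
      exact irrational_sqrt_two
    have hsub : (AddSubgroup.closure {√2, 1} : Set ℝ) ⊆
        {t : ℝ | (Pi.single j t : Fin d → ℝ) ∈ Q} := by
      intro t ht
      -- `Q` is only known to be closed under sums, so `t` and `-t` are carried together; this is
      -- why the generators come with both signs.
      suffices (Pi.single j t : Fin d → ℝ) ∈ Q ∧ (Pi.single j (-t) : Fin d → ℝ) ∈ Q from this.1
      induction ht using AddSubgroup.closure_induction with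
      | mem x hx =>
        rcases hx with rfl | rfl
        · exact ⟨by simpa using hgen j true false, by simpa using hgen j false false⟩
        · exact ⟨by simpa using hgen j true true, by simpa using hgen j false true⟩
      | zero => simpa using hQ0
      | add x y _ _ hx hy =>
        rw [neg_add, Pi.single_add, Pi.single_add]
        exact ⟨hQadd _ hx.1 _ hy.1, hQadd _ hx.2 _ hy.2⟩
      | neg x _ hx => exact ⟨hx.2, by simpa using hx.1⟩
    exact closure_minimal hsub hcl (hdense t)
  have hsum : ∀ s : Finset (Fin d), ∑ j ∈ s, Pi.single j (h j) ∈ Q := by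
    intro s
    induction s using Finset.induction_on with
    | empty => simpa using hQ0
    | insert j s hj ih =>
      rw [Finset.sum_insert hj]
      exact hQadd _ (hsingle j _) _ ih
  have := hsum Finset.univ
  rwa [Finset.univ_sum_single] at this

theorem translation_coeff_mem_expPolynomials {W : Submodule ℂ C(Fin d → ℝ, Y)} (hW : W.FG)
    (hi : ∀ h, W ≤ W.comap (translation Y h)) {F : C(Fin d → ℝ, Y)} (hF : F ∈ W)
    (l : Module.Dual ℂ W) :
    (fun h => l ⟨translation Y h F, hi h hF⟩) ∈ expPolynomials d := by
  have : FiniteDimensional ℂ W := Module.Finite.iff_fg.2 hW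
  let e : W ≃ₗ[ℂ] (Fin (Module.finrank ℂ W) → ℂ) := (Module.finBasis ℂ W).equivFun
  have hec : Continuous e := LinearMap.continuous_of_finiteDimensional e.toLinearMap
  let ρ : (Fin d → ℝ) → Module.End ℂ W := fun h => (translation Y h).restrict (hi h)
  have hρ0 : ρ 0 = 1 := by
    ext F x
    simp [ρ]
  have hρadd : ∀ x y, ρ (x + y) = ρ x * ρ y := by
    intro x y
    ext F z
    simp [ρ, AddChar.map_add_eq_mul]
  have := matrixCoeff_mem_expPolynomials (fun h => e.conj (ρ h))
    (by rw [hρ0]; exact e.conj_id) (fun x y => by rw [hρadd]; exact e.conj_comp _ _) (fun v => by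
      simp only [LinearEquiv.conj_apply_apply, ρ, LinearMap.restrict_apply]
      exact hec.comp ((continuous_translation _).subtype_mk _)) (e ⟨F, hF⟩)
    (l ∘ₗ e.symm.toLinearMap)
  simpa [LinearEquiv.conj_apply_apply, ρ, LinearMap.restrict_apply] using this

theorem exists_translation_eq_sum {F : C(Fin d → ℝ, Y)}
    (hF : F ∈ finiteVectors (translation (G := Fin d → ℝ) Y)) :
    ∃ (n : ℕ) (A : Fin n → (Fin d → ℝ) → ℂ) (b : Fin n → C(Fin d → ℝ, Y)),
      (∀ k, A k ∈ expPolynomials d) ∧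
      (∀ k, b k ∈ Submodule.span ℂ (Set.range fun y => translation Y y F)) ∧
      ∀ h, translation Y h F = ∑ k, A k h • b k := by
  set W := Submodule.span ℂ (Set.range fun y => translation Y y F)
  have hW : W.FG := by
    obtain ⟨V, hV, hVi, hFV⟩ := hF
    refine hV.of_le (Submodule.span_le.2 ?_)
    rintro _ ⟨y, rfl⟩
    exact hVi y hFV
  have hWi : ∀ h, W ≤ W.comap (translation Y h) := span_orbit_invariant _
  have hFW : F ∈ W := mem_span_orbit _
  have : FiniteDimensional ℂ W := Module.Finite.iff_fg.2 hW
  let b := Module.finBasis ℂ W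
  refine ⟨_, fun k h => b.coord k ⟨_, hWi h hFW⟩, fun k => b k, fun k =>
    translation_coeff_mem_expPolynomials hW hWi hFW (b.coord k), fun k => (b k).2, fun h => ?_⟩
  have := congrArg (Submodule.subtype W) (b.sum_repr ⟨_, hWi h hFW⟩)
  simp only [map_sum, map_smul] at this
  exact this.symm

end ContinuousTranslation

/-! ### Mollification of locally integrable functions -/

section Mollification

open MeasureTheory
open scoped Convolution ContDiff

variable {d : ℕ}

/-- The space of locally integrable functions on `ℝ^d`. -/
def locInt (d : ℕ) : Submodule ℂ ((Fin d → ℝ) → ℂ) where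
  carrier := {f | LocallyIntegrable f volume}
  add_mem' hf hg := hf.add hg
  zero_mem' := locallyIntegrable_zero
  smul_mem' c _ hf := hf.smul c

theorem comp_add_right_mem_locInt {f : (Fin d → ℝ) → ℂ} (hf : f ∈ locInt d) (h : Fin d → ℝ) :
    (fun x => f (x + h)) ∈ locInt d := by
  have := (locallyIntegrable_map_homeomorph (Homeomorph.addRight h) (f := f)
    (μ := (volume : Measure (Fin d → ℝ)))).1 (by
      rw [Homeomorph.coe_addRight, map_add_right_eq_self]
      exact hf)
  exact this

theorem comp_mulVec_mem_locInt {f : (Fin d → ℝ) → ℂ} (hf : f ∈ locInt d)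
    {M : Matrix (Fin d) (Fin d) ℝ} (hM : IsUnit M) :
    (fun x => f (M.mulVec x)) ∈ locInt d := by
  have hdet : M.det ≠ 0 := ((Matrix.isUnit_iff_isUnit_det M).1 hM).ne_zero
  let e : (Fin d → ℝ) ≃ₜ (Fin d → ℝ) :=
    (LinearEquiv.ofBijective M.toLin' ⟨Matrix.mulVec_injective_iff_isUnit.2 hM,
      Matrix.mulVec_surjective_iff_isUnit.2 hM⟩).toContinuousLinearEquiv.toHomeomorph
  have := (locallyIntegrable_map_homeomorph e (f := f)
    (μ := (volume : Measure (Fin d → ℝ)))).1 (by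
      have : Measure.map e volume = Measure.map M.toLin' volume := rfl
      rw [this, Real.map_matrix_volume_pi_eq_smul_volume_pi hdet]
      intro x
      obtain ⟨U, hU, hfU⟩ := hf x
      refine ⟨U, hU, ?_⟩
      rw [IntegrableOn, Measure.restrict_smul]
      exact hfU.smul_measure ENNReal.ofReal_ne_top)
  exact this

/-- Smooth compactly supported functions on `ℝ^d`. -/
def Bump (d : ℕ) : Type := {φ : (Fin d → ℝ) → ℝ // ContDiff ℝ ∞ φ ∧ HasCompactSupport φ}

theorem convolutionExists_bump (φ : Bump d) {f : (Fin d → ℝ) → ℂ} (hf : f ∈ locInt d) :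
    ConvolutionExists φ.1 f (ContinuousLinearMap.lsmul ℝ ℝ) volume :=
  φ.2.2.convolutionExists_left _ φ.2.1.continuous hf

/-- The family of all smooth mollifications of a locally integrable function. -/
noncomputable def mollify (d : ℕ) : locInt d →ₗ[ℂ] C(Fin d → ℝ, Bump d → ℂ) where
  toFun f := ⟨fun h φ => (φ.1 ⋆[ContinuousLinearMap.lsmul ℝ ℝ, volume] (f : (Fin d → ℝ) → ℂ)) h,
    continuous_pi fun φ => φ.2.2.continuous_convolution_left _ φ.2.1.continuous f.2⟩
  map_add' f g := by
    ext h φ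
    exact congrFun ((convolutionExists_bump φ f.2).distrib_add (convolutionExists_bump φ g.2)) h
  map_smul' c f := by
    ext h φ
    simp only [convolution, ContinuousLinearMap.lsmul_apply, ContinuousMap.coe_mk, RingHom.id_apply,
      ContinuousMap.smul_apply, Pi.smul_apply, SetLike.val_smul]
    rw [← integral_smul]
    exact integral_congr_ae (.of_forall fun t => smul_comm _ _ _)

theorem mollify_apply (f : locInt d) (h : Fin d → ℝ) (φ : Bump d) :
    mollify d f h φ = ∫ t, φ.1 t • (f : (Fin d → ℝ) → ℂ) (h - t) := rfl

theorem mollify_eq_of_ae_eq {f g : locInt d} (h : (f : (Fin d → ℝ) → ℂ) =ᵐ[volume] g) :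
    mollify d f = mollify d g := by
  ext x φ
  rw [mollify_apply, mollify_apply]
  refine integral_congr_ae ?_
  have := (volume.measurePreserving_sub_left x).quasiMeasurePreserving.ae h
  filter_upwards [this] with t ht
  rw [ht]

theorem ae_eq_of_mollify_eq {f g : locInt d} (h : mollify d f = mollify d g) :
    (f : (Fin d → ℝ) → ℂ) =ᵐ[volume] g := by
  have h0 : mollify d (f - g) = 0 := by rw [map_sub, h, sub_self]
  have : ∀ᵐ x, ((f - g : locInt d) : (Fin d → ℝ) → ℂ) x = 0 := by
    refine ae_eq_zero_of_integral_contDiff_smul_eq_zero (f - g).2 fun φ hφ hφc => ?_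
    -- Convolution with the reflected test function, evaluated at `0`, is integration against `φ`.
    have h1 := congrFun (congrArg (fun F : C(Fin d → ℝ, Bump d → ℂ) => F 0) h0)
      ⟨fun x => φ (-x), hφ.comp contDiff_neg, hφc.comp_homeomorph (Homeomorph.neg _)⟩
    replace h1 : ∫ t, φ (-t) • ((f - g : locInt d) : (Fin d → ℝ) → ℂ) (0 - t) = 0 := h1
    rw [← integral_neg_eq_self]
    simpa only [zero_sub] using h1
  filter_upwards [this] with x hx
  exact sub_eq_zero.1 hx

theorem mollify_comp_add_right (f : locInt d) (h : Fin d → ℝ) :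
    mollify d ⟨_, comp_add_right_mem_locInt f.2 h⟩ = translation _ h (mollify d f) := by
  ext x φ
  simp only [translation_apply, mollify_apply, sub_add_eq_add_sub]

/-- A locally integrable function whose translates span a finite-dimensional space coincides with an
exponential polynomial almost everywhere. -/
theorem exists_isExpPolynomial_ae_eq (f : locInt d)
    (hf : mollify d f ∈ finiteVectors (translation (G := Fin d → ℝ) (Bump d → ℂ))) :
    ∃ p, IsExpPolynomial p ∧ (f : (Fin d → ℝ) → ℂ) =ᵐ[volume] p := by
  obtain ⟨n, A, b, hAexp, hb, hfb⟩ := exists_translation_eq_sum hf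
  have hbr : Submodule.span ℂ (Set.range fun y => translation _ y (mollify d f)) ≤
      LinearMap.range (mollify d) := by
    refine Submodule.span_le.2 ?_
    rintro _ ⟨y, rfl⟩
    exact ⟨_, mollify_comp_add_right f y⟩
  -- The basis vectors lie in the orbit span, so they are mollifications of actual functions `g k`.
  choose g hg using fun k => hbr (hb k)
  have hfg : ∀ h, ∀ᵐ x, (f : (Fin d → ℝ) → ℂ) (x + h) =
      ∑ k, A k h * (g k : (Fin d → ℝ) → ℂ) x := by
    intro h
    have e : mollify d ⟨_, comp_add_right_mem_locInt f.2 h⟩ = mollify d (∑ k, A k h • g k) := by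
      rw [mollify_comp_add_right, map_sum, hfb]
      simp only [map_smul, hg]
    filter_upwards [ae_eq_of_mollify_eq e] with x hx
    simpa using hx
  have hfm := f.2.aestronglyMeasurable
  have hgm := fun k => (g k).2.aestronglyMeasurable
  have hprod : ∀ᵐ h : Fin d → ℝ, ∀ᵐ x : Fin d → ℝ,
      hfm.mk _ (x + h) = ∑ k, A k h * (hgm k).mk _ x := by
    refine Filter.Eventually.of_forall fun h => ?_
    have h1 := (measurePreserving_add_right volume h).quasiMeasurePreserving.ae hfm.ae_eq_mk
    have h2 := ae_all_iff.2 fun k => (hgm k).ae_eq_mk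
    filter_upwards [hfg h, h1, h2] with x hx hx1 hx2
    rw [← hx1, hx]
    exact Finset.sum_congr rfl fun k _ => by rw [hx2 k]
  -- Fubini: for almost every `x` the identity holds for almost every `h`. Fixing one such `x` gives
  -- `f z = ∑ A k (z - x) * c k` almost everywhere.
  rw [Measure.ae_ae_comm] at hprod
  swap
  · refine measurableSet_eq_fun ?_ ?_
    · exact hfm.stronglyMeasurable_mk.measurable.comp (by fun_prop)
    · refine Finset.measurable_sum _ fun k _ => Measurable.mul ?_ ?_
      · exact (hAexp k).continuous.measurable.comp measurable_fst
      · exact (hgm k).stronglyMeasurable_mk.measurable.comp measurable_snd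
  obtain ⟨x, hx⟩ := hprod.exists
  set c := fun k => (hgm k).mk _ x with hc
  refine ⟨fun z => ∑ k, A k (z + -x) * c k, ?_, ?_⟩
  · have : (fun z => ∑ k, A k (z + -x) * c k) =
        ∑ k, c k • fun z => A k (Matrix.mulVec 1 z + -x) := by
      ext z
      simp only [Finset.sum_apply, Pi.smul_apply, smul_eq_mul, Matrix.one_mulVec]
      exact Finset.sum_congr rfl fun k _ => mul_comm _ _
    rw [this]
    exact Subalgebra.sum_mem _ fun k _ =>
      Subalgebra.smul_mem _
        (mem_expPolynomials.2 (IsExpPolynomial.comp_affine (hAexp k) 1 (-x))) _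
  · have h1 := (measurePreserving_add_right volume (-x)).quasiMeasurePreserving.ae hx
    filter_upwards [h1, hfm.ae_eq_mk] with z hz hz1
    rw [hz1, ← hz, add_neg_cancel_comm_assoc]

end Mollification

/-! ### The equation for translates, almost everywhere and pointwise -/

section LeviCivita

open MeasureTheory

variable {d : ℕ}

/-- The action of an additive group on all functions by translations. -/
def funTranslation (G : Type*) [AddCommGroup G] : AddChar G (Module.End ℂ (G → ℂ)) where
  toFun h := LinearMap.funLeft ℂ ℂ (· + h)
  map_zero_eq_one' := by
    ext f x
    simp [LinearMap.funLeft_apply]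
  map_add_eq_mul' a b := by
    ext f x
    simp [LinearMap.funLeft_apply, add_comm a b, add_assoc]

@[simp]
theorem funTranslation_apply {G : Type*} [AddCommGroup G] (h : G) (f : G → ℂ) (x : G) :
    funTranslation G h f x = f (x + h) := rfl

/-- The space of functions that vanish almost everywhere. -/
def nullFunctions (d : ℕ) : Submodule ℂ ((Fin d → ℝ) → ℂ) where
  carrier := {f | f =ᵐ[volume] 0}
  add_mem' {f g} (hf : f =ᵐ[volume] 0) (hg : g =ᵐ[volume] 0) := by
    change f + g =ᵐ[volume] 0
    simpa using hf.add hg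
  zero_mem' := by
    change 0 =ᵐ[volume] 0
    rfl
  smul_mem' c f (hf : f =ᵐ[volume] 0) := by
    change c • f =ᵐ[volume] 0
    simpa using hf.const_smul c

theorem nullFunctions_invariant (h : Fin d → ℝ) :
    nullFunctions d ≤ (nullFunctions d).comap (funTranslation _ h) := fun _ hf =>
  (measurePreserving_add_right volume h).quasiMeasurePreserving.ae hf

/-- Finitely many null functions have a common zero `x`, at which all of `V` vanishes; the value of
`f` at `z` is that of its translate by `z - x` at `x`. -/
theorem eq_zero_of_translates_mem {V : Submodule ℂ ((Fin d → ℝ) → ℂ)} (hV : V.FG)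
    (hVN : V ≤ nullFunctions d) {f : (Fin d → ℝ) → ℂ} (hf : ∀ y, funTranslation _ y f ∈ V) :
    f = 0 := by
  obtain ⟨s, rfl⟩ := hV
  have hs : ∀ᵐ x, ∀ v ∈ s, v x = 0 :=
    (Filter.eventually_all_finset s).2 fun v hv => hVN (Submodule.subset_span hv)
  obtain ⟨x, hx⟩ := hs.exists
  have hV : Submodule.span ℂ (s : Set ((Fin d → ℝ) → ℂ)) ≤
      LinearMap.ker (LinearMap.proj (R := ℂ) (φ := fun _ : Fin d → ℝ => ℂ) x) :=
    Submodule.span_le.2 hx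
  ext z
  have := hV (hf (z - x))
  simpa using this

theorem expPolynomials_inf_nullFunctions :
    (expPolynomials d).toSubmodule ⊓ nullFunctions d = ⊥ := by
  rw [eq_bot_iff]
  rintro f ⟨hf, hf0⟩
  exact (Continuous.ae_eq_iff_eq volume (IsExpPolynomial.continuous hf) continuous_const).1 hf0

/-- A null exponential polynomial is zero by continuity, so this space injects into the image of `V`
modulo exponential polynomials. -/
theorem fg_nullFunctions_inf_sup {V : Submodule ℂ ((Fin d → ℝ) → ℂ)} (hV : V.FG) :
    (nullFunctions d ⊓ (V ⊔ (expPolynomials d).toSubmodule)).FG := by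
  set E := (expPolynomials d).toSubmodule
  refine Submodule.fg_of_fg_map_of_fg_inf_ker E.mkQ ((hV.map E.mkQ).of_le ?_) ?_
  · refine (Submodule.map_mono inf_le_right).trans ?_
    rw [Submodule.map_sup, E.mkQ_map_self, sup_bot_eq]
  · rw [Submodule.ker_mkQ]
    have : nullFunctions d ⊓ (V ⊔ E) ⊓ E = ⊥ := by
      rw [eq_bot_iff, ← expPolynomials_inf_nullFunctions]
      exact le_inf inf_le_right (inf_le_left.trans inf_le_left)
    rw [this]
    exact Submodule.fg_bot

theorem IsExpPolynomial.comp_add_right {f : (Fin d → ℝ) → ℂ} (hf : IsExpPolynomial f)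
    (h : Fin d → ℝ) : IsExpPolynomial fun x => f (x + h) := by
  simpa using hf.comp_affine (1 : Matrix (Fin d) (Fin d) ℝ) h

/-- Mollification commutes with translation, so it carries invariant finite-dimensional spaces to
such spaces. -/
theorem mollify_mem_finiteVectors {f : (Fin d → ℝ) → ℂ} (hf : IsExpPolynomial f)
    (hfl : f ∈ locInt d) :
    mollify d ⟨f, hfl⟩ ∈ finiteVectors (translation (G := Fin d → ℝ) (Bump d → ℂ)) := by
  have hcont : ∀ F : C(Fin d → ℝ, ℂ), (F : (Fin d → ℝ) → ℂ) ∈ locInt d :=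
    fun F => F.continuous.locallyIntegrable
  let ι : C(Fin d → ℝ, ℂ) →ₗ[ℂ] locInt d :=
    { toFun := fun F => ⟨F, hcont F⟩
      map_add' := fun _ _ => rfl
      map_smul' := fun _ _ => rfl }
  have hle : finiteVectors (translation (G := Fin d → ℝ) ℂ) ≤
      (finiteVectors (translation (G := Fin d → ℝ) (Bump d → ℂ))).comap (mollify d ∘ₗ ι) := by
    rintro F ⟨W, hW, hWi, hFW⟩
    refine ⟨W.map (mollify d ∘ₗ ι), hW.map _, fun h => ?_, Submodule.mem_map_of_mem hFW⟩
    rintro _ ⟨H, hH, rfl⟩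
    exact ⟨translation ℂ h H, hWi h hH, mollify_comp_add_right (ι H) h⟩
  obtain ⟨N, P, ξ, hP⟩ := hf
  have hsum : (⟨f, hfl⟩ : locInt d) = ∑ s, ι ⟨polyExp (P s) (ξ s), continuous_polyExp _ _⟩ := by
    ext x
    simp [hP, ι]
  rw [hsum, map_sum]
  exact Submodule.sum_mem _ fun s _ => hle (polyExp_mem_finiteVectors (P s) (ξ s))

variable {m n : ℕ} {a : Fin m → Matrix (Fin d) (Fin d) ℝ} {g : Fin m → (Fin d → ℝ) → ℂ}
    {v : Fin n → (Fin d → ℝ) → ℂ}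

theorem exists_isExpPolynomial_ae_eq_of_sum_translates (ha : ∀ i, IsUnit (a i))
    (hab : ∀ i j, i ≠ j → IsUnit (a i - a j)) (hg : ∀ i, g i ∈ locInt d)
    (hv : ∀ k, v k ∈ locInt d)
    (h : ∀ y, ∃ c : Fin n → ℂ, ∃ e ∈ expPolynomials d, ∀ᵐ x : Fin d → ℝ,
      ∑ i, g i (x + (a i).mulVec y) = ∑ k, c k * v k x + e x) (i : Fin m) :
    ∃ p, IsExpPolynomial p ∧ g i =ᵐ[volume] p := by
  refine exists_isExpPolynomial_ae_eq ⟨g i, hg i⟩ ?_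
  set V := Submodule.span ℂ (Set.range fun k => mollify d ⟨v k, hv k⟩)
  have hV : V.FG := Submodule.fg_span (Set.finite_range _)
  refine mem_of_sum_translates_mem (τ := translation (G := Fin d → ℝ) (Bump d → ℂ))
    (fun i => (Matrix.mulVecLin (a i)).toAddMonoidHom)
    (fun i => Matrix.mulVec_surjective_iff_isUnit.2 (ha i)) (fun i j hij => ?_)
    (N := ⊤) (fun _ => le_top) finiteVectors_invariant
    (fun V hV _ f _ hf => mem_finiteVectors_of_orbit _ (Set.finite_range _)
      (fun W hW hi => invariant_of_invariant_denseGenerators hW hi) hV hf)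
    Finset.univ (fun i => mollify d ⟨g i, hg i⟩) (fun _ _ => trivial) V hV le_top (fun y => ?_)
    i (Finset.mem_univ i)
  · convert Matrix.mulVec_surjective_iff_isUnit.2 (hab i j hij) using 1
    ext y l
    simp [Matrix.sub_mulVec]
  · obtain ⟨c, e, he, hce⟩ := h y
    have hel : e ∈ locInt d := (IsExpPolynomial.continuous he).locallyIntegrable
    have key : ∑ i, translation (Bump d → ℂ) ((a i).mulVec y) (mollify d ⟨g i, hg i⟩) =
        ∑ k, c k • mollify d ⟨v k, hv k⟩ + mollify d ⟨e, hel⟩ := by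
      simp_rw [← mollify_comp_add_right, ← map_smul, ← map_sum]
      rw [← map_add]
      refine mollify_eq_of_ae_eq ?_
      filter_upwards [hce] with x hx
      simpa using hx
    change ∑ i, translation (Bump d → ℂ) ((a i).mulVec y) (mollify d ⟨g i, hg i⟩) ∈ _
    rw [key]
    exact Submodule.add_mem_sup (Submodule.sum_mem _ fun k _ =>
      Submodule.smul_mem _ _ (Submodule.subset_span ⟨k, rfl⟩)) (mollify_mem_finiteVectors he hel)

theorem isExpPolynomial_of_sum_translates (ha : ∀ i, IsUnit (a i))
    (hab : ∀ i j, i ≠ j → IsUnit (a i - a j)) (hg : ∀ i, g i ∈ locInt d)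
    (hv : ∀ k, v k ∈ locInt d)
    (h : ∀ y, ∃ c : Fin n → ℂ, ∃ e ∈ expPolynomials d, ∀ x : Fin d → ℝ,
      ∑ i, g i (x + (a i).mulVec y) = ∑ k, c k * v k x + e x) (i : Fin m) :
    IsExpPolynomial (g i) := by
  choose p hp hgp using exists_isExpPolynomial_ae_eq_of_sum_translates ha hab hg hv fun y =>
    let ⟨c, e, he, hce⟩ := h y
    ⟨c, e, he, .of_forall hce⟩
  -- The differences `g i - p i` are null and their translated sums lie in `V` plus exponential
  -- polynomials, so elimination runs inside `nullFunctions d` with `T = ⊥`.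
  suffices g i - p i ∈ (⊥ : Submodule ℂ ((Fin d → ℝ) → ℂ)) by
    rw [sub_eq_zero.1 ((Submodule.mem_bot ℂ).1 this)]
    exact hp i
  set V := Submodule.span ℂ (Set.range v)
  have hV : V.FG := Submodule.fg_span (Set.finite_range _)
  have hnull : ∀ i, g i - p i ∈ nullFunctions d := fun i => by
    filter_upwards [hgp i] with x hx
    simp [hx]
  refine mem_of_sum_translates_mem (τ := funTranslation (Fin d → ℝ))
    (fun i => (Matrix.mulVecLin (a i)).toAddMonoidHom)
    (fun i => Matrix.mulVec_surjective_iff_isUnit.2 (ha i)) (fun i j hij => ?_)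
    (N := nullFunctions d) nullFunctions_invariant (fun _ => bot_le)
    (fun V hV hVN f _ hf => (Submodule.mem_bot ℂ).2 (eq_zero_of_translates_mem hV hVN fun y => by
      simpa only [sup_bot_eq] using hf y))
    Finset.univ (fun i => g i - p i) (fun i _ => hnull i) _ (fg_nullFunctions_inf_sup hV)
    inf_le_left (fun y => Submodule.mem_sup_left ⟨?_, ?_⟩) i (Finset.mem_univ i)
  · convert Matrix.mulVec_surjective_iff_isUnit.2 (hab i j hij) using 1
    ext y l
    simp [Matrix.sub_mulVec]
  · exact Submodule.sum_mem _ fun i _ => nullFunctions_invariant _ (hnull i)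
  · obtain ⟨c, e, he, hce⟩ := h y
    have key : ∑ i, funTranslation _ ((a i).mulVec y) (g i - p i) = ∑ k, c k • v k +
        (e - ∑ i, fun x => p i (x + (a i).mulVec y)) := by
      ext x
      simp only [Finset.sum_apply, funTranslation_apply, Pi.sub_apply, Finset.sum_sub_distrib, hce,
        Pi.add_apply, Pi.smul_apply, smul_eq_mul]
      ring
    change ∑ i, funTranslation _ ((a i).mulVec y) (g i - p i) ∈ _
    rw [key]
    exact Submodule.add_mem_sup (Submodule.sum_mem _ fun k _ =>
      Submodule.smul_mem _ _ (Submodule.subset_span ⟨k, rfl⟩))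
      (Subalgebra.sub_mem _ he (Subalgebra.sum_mem _ fun i _ => (hp i).comp_add_right _))

/-! ### Linear changes of variables -/

variable {b c : Fin m → Matrix (Fin d) (Fin d) ℝ} {f : Fin m → (Fin d → ℝ) → ℂ}

theorem mulVec_add_mulVec_eq {B : Matrix (Fin d) (Fin d) ℝ} (hB : IsUnit B)
    (C : Matrix (Fin d) (Fin d) ℝ) (x y : Fin d → ℝ) :
    B.mulVec x + C.mulVec y = B.mulVec (x + (B⁻¹ * C).mulVec y) := by
  rw [Matrix.mulVec_add, Matrix.mulVec_mulVec,
    Matrix.mul_nonsing_inv_cancel_left _ _ ((Matrix.isUnit_iff_isUnit_det B).1 hB)]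

theorem mulVec_inv_mulVec {B : Matrix (Fin d) (Fin d) ℝ} (hB : IsUnit B) (x : Fin d → ℝ) :
    B.mulVec (B⁻¹.mulVec x) = x := by
  rw [Matrix.mulVec_mulVec, Matrix.mul_nonsing_inv _ ((Matrix.isUnit_iff_isUnit_det B).1 hB),
    Matrix.one_mulVec]

theorem exists_isExpPolynomial_ae_eq_of_functional_equation (hb : ∀ i, IsUnit (b i))
    (hc : ∀ i, IsUnit (c i)) (hbc : ∀ i j, i ≠ j → IsUnit ((b i)⁻¹ * c i - (b j)⁻¹ * c j))
    (hf : ∀ i, f i ∈ locInt d) (hv : ∀ k, v k ∈ locInt d)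
    (h : ∀ y, ∃ u : Fin n → ℂ, ∃ e ∈ expPolynomials d, ∀ᵐ x : Fin d → ℝ,
      ∑ i, f i ((b i).mulVec x + (c i).mulVec y) = ∑ k, u k * v k x + e x) (i : Fin m) :
    ∃ p, IsExpPolynomial p ∧ f i =ᵐ[volume] p := by
  simp_rw [fun i => mulVec_add_mulVec_eq (hb i) (c i)] at h
  obtain ⟨p, hp, hfp⟩ := exists_isExpPolynomial_ae_eq_of_sum_translates
    (fun i => ((Matrix.isUnit_nonsing_inv_iff).2 (hb i)).mul (hc i)) hbc
    (fun i => comp_mulVec_mem_locInt (hf i) (hb i)) hv h i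
  have hbi := Matrix.isUnit_nonsing_inv_iff.2 (hb i)
  refine ⟨fun x => p ((b i)⁻¹.mulVec x), by simpa using hp.comp_affine (b i)⁻¹ 0, ?_⟩
  have hq : Measure.QuasiMeasurePreserving (Matrix.toLin' (b i)⁻¹) volume volume := by
    refine ⟨(LinearMap.continuous_of_finiteDimensional _).measurable, ?_⟩
    rw [Real.map_matrix_volume_pi_eq_smul_volume_pi
      ((Matrix.isUnit_iff_isUnit_det _).1 hbi).ne_zero]
    exact Measure.smul_absolutelyContinuous
  filter_upwards [hq.ae hfp] with x hx
  rw [Matrix.toLin'_apply, mulVec_inv_mulVec (hb i)] at hx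
  exact hx

theorem isExpPolynomial_of_functional_equation (hb : ∀ i, IsUnit (b i))
    (hc : ∀ i, IsUnit (c i)) (hbc : ∀ i j, i ≠ j → IsUnit ((b i)⁻¹ * c i - (b j)⁻¹ * c j))
    (hf : ∀ i, f i ∈ locInt d) (hv : ∀ k, v k ∈ locInt d)
    (h : ∀ y, ∃ u : Fin n → ℂ, ∃ e ∈ expPolynomials d, ∀ x : Fin d → ℝ,
      ∑ i, f i ((b i).mulVec x + (c i).mulVec y) = ∑ k, u k * v k x + e x) (i : Fin m) :
    IsExpPolynomial (f i) := by
  simp_rw [fun i => mulVec_add_mulVec_eq (hb i) (c i)] at h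
  have := (isExpPolynomial_of_sum_translates
    (fun i => ((Matrix.isUnit_nonsing_inv_iff).2 (hb i)).mul (hc i)) hbc
    (fun i => comp_mulVec_mem_locInt (hf i) (hb i)) hv h i).comp_affine (b i)⁻¹ 0
  simpa only [add_zero, mulVec_inv_mulVec (hb i)] using this

/-- With `y` fixed, the extra terms are a single exponential polynomial in `x`; this is why `w` and
`φ` may depend on `y` arbitrarily. -/
theorem sum_mul_polyExp_mem_expPolynomials {N : ℕ} (P : Fin N → MvPolynomial (Fin d) ℂ)
    (w : Fin N → ℂ) (ξ : Fin N → Fin d → ℂ) :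
    (fun x => ∑ s, w s * polyExp (P s) (ξ s) x) ∈ expPolynomials d := by
  have : (fun x => ∑ s, w s * polyExp (P s) (ξ s) x) = ∑ s, w s • polyExp (P s) (ξ s) := by
    ext x
    simp
  rw [this]
  exact Subalgebra.sum_mem _ fun s _ => Subalgebra.smul_mem _ (isExpPolynomial_polyExp _ _) _

end LeviCivita

theorem mainTheorem5 {d m : ℕ} (b c : Fin m → Matrix (Fin d) (Fin d) ℝ)
    (hb : ∀ i, IsUnit (b i)) (hc : ∀ i, IsUnit (c i))
    (hbc : ∀ i j, i ≠ j → IsUnit ((b i)⁻¹ * c i - (b j)⁻¹ * c j))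
    (f : Fin m → (Fin d → ℝ) → ℂ)
    (hf : ∀ i, MeasureTheory.LocallyIntegrable (f i) MeasureTheory.volume)
    {n : ℕ} (u v : Fin n → (Fin d → ℝ) → ℂ)
    (hv : ∀ k, MeasureTheory.LocallyIntegrable (v k) MeasureTheory.volume) :
    -- the equation with right-hand side `∑ u_k(y) v_k(x)`, read in `L¹_loc` for every `y`
    ((∀ y : Fin d → ℝ, ∀ᵐ x : Fin d → ℝ ∂MeasureTheory.volume,
        ∑ i, f i ((b i).mulVec x + (c i).mulVec y) = ∑ k, u k y * v k x) →
      ∀ i, ∃ p, IsExpPolynomial p ∧ f i =ᵐ[MeasureTheory.volume] p) ∧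
    -- the same equation, read pointwise
    ((∀ y x : Fin d → ℝ,
        ∑ i, f i ((b i).mulVec x + (c i).mulVec y) = ∑ k, u k y * v k x) →
      ∀ i, IsExpPolynomial (f i)) ∧
    -- the equation with the additional terms `P_s(x) w_s(y) exp⟨x, φ_s(y)⟩`
    (∀ (N : ℕ) (P : Fin N → MvPolynomial (Fin d) ℂ) (w : Fin N → (Fin d → ℝ) → ℂ)
        (φ : Fin N → (Fin d → ℝ) → (Fin d → ℂ)),
      ((∀ y : Fin d → ℝ, ∀ᵐ x : Fin d → ℝ ∂MeasureTheory.volume,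
          ∑ i, f i ((b i).mulVec x + (c i).mulVec y) =
            ∑ k, u k y * v k x + ∑ s, w s y * polyExp (P s) (φ s y) x) →
        ∀ i, ∃ p, IsExpPolynomial p ∧ f i =ᵐ[MeasureTheory.volume] p) ∧
      ((∀ y x : Fin d → ℝ,
          ∑ i, f i ((b i).mulVec x + (c i).mulVec y) =
            ∑ k, u k y * v k x + ∑ s, w s y * polyExp (P s) (φ s y) x) →
        ∀ i, IsExpPolynomial (f i))) := by
  refine ⟨fun h => ?_, fun h => ?_, fun N P w φ => ⟨fun h => ?_, fun h => ?_⟩⟩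
  · refine exists_isExpPolynomial_ae_eq_of_functional_equation hb hc hbc hf hv fun y =>
      ⟨fun k => u k y, 0, Subalgebra.zero_mem _, ?_⟩
    simpa using h y
  · refine isExpPolynomial_of_functional_equation hb hc hbc hf hv fun y =>
      ⟨fun k => u k y, 0, Subalgebra.zero_mem _, ?_⟩
    simpa using h y
  · exact exists_isExpPolynomial_ae_eq_of_functional_equation hb hc hbc hf hv fun y =>
      ⟨fun k => u k y, _, sum_mul_polyExp_mem_expPolynomials P (fun s => w s y) (fun s => φ s y),
        h y⟩
  · exact isExpPolynomial_of_functional_equation hb hc hbc hf hv fun y =>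
      ⟨fun k => u k y, _, sum_mul_polyExp_mem_expPolynomials P (fun s => w s y) (fun s => φ s y),
        h y⟩
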